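/- **Proposition 4.5.** Let $X=\mathbb{C}^g/\Lambda$ be a complex abelian variety of dimension $g$ (a complex torus admitting a polarization, i.e. a positive definite Hermitian form on $\mathbb{C}^g$ whose imaginary part is integer-valued on $\Lambda\times\Lambda$). Let $f\colon X\to X$ be an automorphism of the abelian variety $X$ (a holomorphic group automorphism), and let $\rho_a(f)\colon\mathbb{C}^g\to\mathbb{C}^g$ be its analytic representation, i.e. the unique $\mathbb{C}$-linear map inducing $f$. Suppose that $1$ is an eigenvalue of $\rho_a(f)$ of algebraic multiplicity $h$, where $1\le h<g$. Then there are abelian varieties $Y_1$ and $Y_2$ with $\dim Y_1=h$ such that $X$ is isogenous to $Y_1\times Y_2$, that is, there is a surjective homomorphism $X\to Y_1\times Y_2$ with finite kernel. Moreover, $Y_1$ can be taken to be an abelian subvariety of $X$ fixed by $f$, in the sense that $f(Y_1)=Y_1$. -/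

import Mathlib

universe u

/-- A complex torus `V / Λ`: a finite-dimensional complex vector space `V` together with a
full lattice `Λ` in it (a discrete subgroup spanning `V` over `ℝ`). -/
structure ComplexTorus : Type (u + 1) where
  /-- the universal cover -/
  V : Type u
  [normedAddCommGroup : NormedAddCommGroup V]
  [normedSpace : NormedSpace ℂ V]
  [finiteDimensional : FiniteDimensional ℂ V]
  /-- the lattice -/
  Λ : Submodule ℤ V
  [discreteTopology : DiscreteTopology Λ]
  [isZLattice : IsZLattice ℝ Λ]

namespace ComplexTorus

attribute [instance] normedAddCommGroup normedSpace finiteDimensional discreteTopology isZLattice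

/-- The group of points `V / Λ`. -/
abbrev Pt (X : ComplexTorus.{u}) : Type u := X.V ⧸ X.Λ

/-- The projection `V → V / Λ` from the universal cover. -/
abbrev proj (X : ComplexTorus.{u}) : X.V →ₗ[ℤ] X.Pt := X.Λ.mkQ

/-- The complex dimension. -/
noncomputable def dim (X : ComplexTorus.{u}) : ℕ := Module.finrank ℂ X.V

/-- A polarization: a positive definite Hermitian form `H` on `V` whose imaginary part takes
integral values on `Λ × Λ` (such forms are the first Chern classes of the positive definite
line bundles on `V / Λ`). -/
structure IsPolarization (X : ComplexTorus.{u}) (H : X.V →ₗ⋆[ℂ] X.V →ₗ[ℂ] ℂ) : Prop where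
  hermitian : ∀ v w, star (H v w) = H w v
  pos : ∀ v, v ≠ 0 → 0 < (H v v).re
  integral : ∀ l ∈ X.Λ, ∀ m ∈ X.Λ, ∃ n : ℤ, (H l m).im = n

/-- An abelian variety is a complex torus which admits a polarization. -/
def IsAbelianVariety (X : ComplexTorus.{u}) : Prop :=
  ∃ H : X.V →ₗ⋆[ℂ] X.V →ₗ[ℂ] ℂ, X.IsPolarization H

/-- A map of complex tori is holomorphic if it lifts locally to holomorphic maps between the
universal covers (whose projections are the local biholomorphisms defining the complex
structures of the tori). -/
def IsHolomorphic {X Y : ComplexTorus.{u}} (f : X.Pt → Y.Pt) : Prop :=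
  ∀ v : X.V, ∃ U : Set X.V, IsOpen U ∧ v ∈ U ∧
    ∃ F : X.V → Y.V, DifferentiableOn ℂ F U ∧ ∀ u ∈ U, f (X.proj u) = Y.proj (F u)

/-- A homomorphism of complex tori: a holomorphic homomorphism of groups. -/
structure Hom (X Y : ComplexTorus.{u}) where
  toAddMonoidHom : X.Pt →+ Y.Pt
  holomorphic : IsHolomorphic toAddMonoidHom

instance (X Y : ComplexTorus.{u}) : CoeFun (Hom X Y) (fun _ => X.Pt → Y.Pt) :=
  ⟨fun f => f.toAddMonoidHom⟩

theorem exists_small (X : ComplexTorus.{u}) :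
    ∃ ε : ℝ, 0 < ε ∧ ∀ l ∈ X.Λ, ‖l‖ < ε → l = 0 := by
  have h : IsOpen ({0} : Set X.Λ) := isOpen_discrete _
  obtain ⟨ε, hε, hb⟩ := Metric.isOpen_iff.1 h 0 rfl
  refine ⟨ε, hε, fun l hl hn => ?_⟩
  have : (⟨l, hl⟩ : X.Λ) ∈ ({0} : Set X.Λ) := hb (by simpa [Metric.mem_ball, dist_eq_norm] using hn)
  simpa using congrArg Subtype.val (Set.mem_singleton_iff.1 this)

/-- A homomorphism of complex tori is induced by a `ℂ`-linear map of the universal covers. -/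
theorem Hom.exists_lift {X Y : ComplexTorus.{u}} (f : Hom X Y) :
    ∃ L : X.V →ₗ[ℂ] Y.V, ∀ v, f (X.proj v) = Y.proj (L v) := by
  obtain ⟨U, hU, h0, F, hF, hl⟩ := f.holomorphic 0
  obtain ⟨ε, hε, hsm⟩ := Y.exists_small
  have hF0 : F 0 ∈ Y.Λ := by
    have := hl 0 h0
    rw [map_zero, map_zero] at this
    exact (Submodule.Quotient.mk_eq_zero _).1 this.symm
  set G : X.V → Y.V := fun u => F u - F 0 with hG
  have hGl : ∀ u ∈ U, f (X.proj u) = Y.proj (G u) := by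
    intro u hu
    rw [hl u hu, hG]
    simp only [map_sub]
    rw [show Y.proj (F 0) = 0 from (Submodule.Quotient.mk_eq_zero _).2 hF0, sub_zero]
  have hd : DifferentiableAt ℂ G 0 :=
    ((hF 0 h0).differentiableAt (hU.mem_nhds h0)).sub_const _
  have hG0 : G 0 = 0 := by simp [hG]
  have hev : ∀ᶠ u in nhds (0 : X.V), u ∈ U ∧ ‖G u‖ < ε / 3 := by
    refine Filter.Eventually.and (hU.mem_nhds h0) ?_
    exact hd.continuousAt.norm.eventually_lt_const (by simpa [hG0] using hε)
  obtain ⟨δ, hδ, hball⟩ := Metric.eventually_nhds_iff.1 hev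
  simp only [dist_zero_right] at hball
  have hhalf : ∀ u : X.V, ‖u‖ < δ → G u = (2 : ℂ) • G ((2 : ℂ)⁻¹ • u) := by
    intro u hu
    have hu' : ‖(2 : ℂ)⁻¹ • u‖ < δ := by
      rw [norm_smul]; norm_num; linarith [norm_nonneg u]
    obtain ⟨a1, a2⟩ := hball hu
    obtain ⟨b1, b2⟩ := hball hu'
    rw [← sub_eq_zero]
    apply hsm
    · apply (Submodule.Quotient.mk_eq_zero Y.Λ).1
      change Y.proj _ = 0
      rw [map_sub, two_smul, map_add, ← hGl _ a1, ← hGl _ b1, ← map_add, ← map_add, ← two_smul ℂ,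
        smul_smul]
      norm_num
    · calc _ ≤ ‖G u‖ + ‖(2 : ℂ) • G ((2 : ℂ)⁻¹ • u)‖ := norm_sub_le _ _
        _ < ε := by rw [norm_smul]; norm_num; linarith
  have hiter : ∀ n : ℕ, ∀ u : X.V, ‖u‖ < δ → ((2 : ℂ) ^ n) • G (((2 : ℂ) ^ n)⁻¹ • u) = G u := by
    intro n
    induction n with
    | zero => intro u _; simp
    | succ n ih =>
      intro u hu
      have hu' : ‖((2 : ℂ) ^ n)⁻¹ • u‖ < δ := by
        rw [norm_smul, norm_inv, norm_pow]
        refine lt_of_le_of_lt (mul_le_of_le_one_left (norm_nonneg _) ?_) hu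
        apply inv_le_one_of_one_le₀
        apply one_le_pow₀
        norm_num
      rw [← ih u hu, hhalf _ hu', smul_smul, smul_smul, pow_succ, mul_inv, mul_comm (2 : ℂ)⁻¹]
  set L := fderiv ℂ G 0 with hL
  have hGL : ∀ u : X.V, ‖u‖ < δ → G u = L u := by
    intro u hu
    have hlim := hd.hasFDerivAt.lim u (c := fun n : ℕ => (2 : ℂ) ^ n) (l := Filter.atTop)
      (by
        simp only [norm_pow]
        exact tendsto_pow_atTop_atTop_of_one_lt (by norm_num))
    simp only [zero_add, hG0, sub_zero] at hlim
    refine tendsto_nhds_unique ?_ hlim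
    refine Filter.Tendsto.congr (fun n => (hiter n u hu).symm) tendsto_const_nhds
  refine ⟨L.toLinearMap, fun v => ?_⟩
  obtain ⟨n, hn⟩ := exists_nat_gt (‖v‖ / δ)
  have hnpos : (0 : ℝ) < n := lt_of_le_of_lt (by positivity) hn
  have hn0 : (n : ℂ) ≠ 0 := by
    have : n ≠ 0 := by rintro rfl; simp at hnpos
    exact_mod_cast this
  have hw : ‖(n : ℂ)⁻¹ • v‖ < δ := by
    rw [norm_smul, norm_inv, Complex.norm_natCast, inv_mul_lt_iff₀ hnpos]
    rwa [div_lt_iff₀ hδ] at hn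
  have hv : v = n • ((n : ℂ)⁻¹ • v) := by
    rw [← Nat.cast_smul_eq_nsmul ℂ, smul_smul, mul_inv_cancel₀ hn0, one_smul]
  have key : f (X.proj ((n : ℂ)⁻¹ • v)) = Y.proj (L ((n : ℂ)⁻¹ • v)) := by
    rw [hGl _ (hball hw).1, hGL _ hw]
  conv_lhs => rw [hv]
  conv_rhs => rw [hv]
  simp only [map_nsmul, ContinuousLinearMap.coe_coe, key]

/-- The analytic representation `ρ_a(f) : V_X → V_Y` of a homomorphism `f : X → Y`: the
`ℂ`-linear map of the universal covers which induces `f`. -/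
noncomputable def Hom.analyticRep {X Y : ComplexTorus.{u}} (f : Hom X Y) : X.V →ₗ[ℂ] Y.V :=
  f.exists_lift.choose

theorem Hom.analyticRep_spec {X Y : ComplexTorus.{u}} (f : Hom X Y) (v : X.V) :
    f (X.proj v) = Y.proj (f.analyticRep v) :=
  f.exists_lift.choose_spec v

/-- The analytic representation is the only `ℂ`-linear map which induces `f`. -/
theorem Hom.eq_analyticRep {X Y : ComplexTorus.{u}} (f : Hom X Y) (L : X.V →ₗ[ℂ] Y.V)
    (hL : ∀ v, f (X.proj v) = Y.proj (L v)) : L = f.analyticRep := by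
  obtain ⟨ε, hε, hsm⟩ := Y.exists_small
  ext v
  set w := L v - f.analyticRep v with hw
  obtain ⟨n, hn⟩ := exists_nat_gt (‖w‖ / ε)
  have hnpos : (0 : ℝ) < n := lt_of_le_of_lt (by positivity) hn
  have hn0 : (n : ℂ) ≠ 0 := by
    have : n ≠ 0 := by rintro rfl; simp at hnpos
    exact_mod_cast this
  have hz : (n : ℂ)⁻¹ • w = 0 := by
    apply hsm
    · apply (Submodule.Quotient.mk_eq_zero Y.Λ).1
      change Y.proj _ = 0
      rw [hw, smul_sub, ← map_smul, ← map_smul, map_sub, ← hL, ← f.analyticRep_spec, sub_self]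
    · rw [norm_smul, norm_inv, Complex.norm_natCast, inv_mul_lt_iff₀ hnpos]
      rwa [div_lt_iff₀ hε] at hn
  rw [smul_eq_zero] at hz
  exact sub_eq_zero.1 (hz.resolve_left (inv_ne_zero hn0))

/-- An endomorphism is an automorphism if it has an inverse among the endomorphisms. -/
def Hom.IsAutomorphism {X : ComplexTorus.{u}} (f : Hom X X) : Prop :=
  ∃ k : Hom X X, (∀ x, k (f x) = x) ∧ ∀ x, f (k x) = x

/-- An isogeny is a surjective homomorphism with finite kernel. -/
def Hom.IsIsogeny {X Y : ComplexTorus.{u}} (f : Hom X Y) : Prop :=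
  Function.Surjective f ∧ {x : X.Pt | f x = 0}.Finite

/-- `X` is isogenous to `Y` if there is an isogeny `X → Y`. -/
def IsIsogenous (X Y : ComplexTorus.{u}) : Prop :=
  ∃ f : Hom X Y, f.IsIsogeny

/-- The product of two lattices, as a subgroup of the product of the vector spaces. -/
abbrev prodLattice (X Y : ComplexTorus.{u}) : Submodule ℤ (X.V × Y.V) := X.Λ.prod Y.Λ

instance (X Y : ComplexTorus.{u}) : DiscreteTopology (prodLattice X Y) := by
  let e : prodLattice X Y → X.Λ × Y.Λ := fun p => (⟨p.1.1, p.2.1⟩, ⟨p.1.2, p.2.2⟩)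
  have he : Continuous e := by fun_prop
  refine DiscreteTopology.of_continuous_injective he ?_
  rintro ⟨⟨a, b⟩, h⟩ ⟨⟨c, d⟩, h'⟩ hh
  simpa [e] using hh

instance (X Y : ComplexTorus.{u}) : IsZLattice ℝ (prodLattice X Y) where
  span_top := by
    have h1 := IsZLattice.span_top (K := ℝ) (L := X.Λ)
    have h2 := IsZLattice.span_top (K := ℝ) (L := Y.Λ)
    have : ((prodLattice X Y : Submodule ℤ (X.V × Y.V)) : Set (X.V × Y.V)) =
      (X.Λ : Set X.V) ×ˢ (Y.Λ : Set Y.V) := rfl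
    rw [this]
    have h3 := Submodule.span_prod_eq (R := ℝ) (s := (X.Λ : Set X.V)) (t := (Y.Λ : Set Y.V))
      X.Λ.zero_mem Y.Λ.zero_mem
    rw [h1, h2, Submodule.prod_top] at h3
    exact h3

/-- The product `X × Y`, i.e. `(V_X × V_Y) / (Λ_X × Λ_Y)`. -/
noncomputable def prod (X Y : ComplexTorus.{u}) : ComplexTorus.{u} where
  V := X.V × Y.V
  Λ := prodLattice X Y

end ComplexTorus

/-! Put `N = ρ_a(f) - 1`, an endomorphism of `V` preserving `Λ`. For large `n`, Fitting's lemma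
gives `V = ker N^n ⊕ range N^n`, where the kernel is the generalized eigenspace at 1, of dimension
`h`. Since `N^n` acts on `Λ`, rank-nullity over `ℤ` shows that the lattice points of the two
summands generate a subgroup of finite index in `Λ` (`exists_nsmul_mem_ker_sup_range`,
`exists_nsmul_eq_add`). Hence each summand is spanned by its lattice points and defines a subtorus,
polarized by restriction. A multiple of the splitting of `V` is the isogeny
(`isIsogenous_prod_sub`), and `ρ_a(f)` maps the eigenspace onto itself (`image_maxGenEigenspace`).
-/

namespace LinearMap

/-- An endomorphism of a finite free `ℤ`-module whose kernel and range are disjoint splits the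
module up to finite index. -/
theorem exists_nsmul_mem_ker_sup_range {M : Type*} [AddCommGroup M] [Module.Free ℤ M]
    [Module.Finite ℤ M] (A : M →ₗ[ℤ] M) (hA : Disjoint (ker A) (range A)) :
    ∃ m : ℕ, m ≠ 0 ∧ ∀ x : M, m • x ∈ ker A ⊔ range A := by
  have hrank : Module.finrank ℤ (ker A ⊔ range A : Submodule ℤ M) = Module.finrank ℤ M := by
    have h := Submodule.rank_sup_add_rank_inf_eq (ker A) (range A)
    rw [hA.eq_bot, rank_bot, add_zero, add_comm, rank_range_add_rank_ker] at h
    simp only [Module.finrank, h]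
  have := Submodule.finiteQuotientOfFreeOfRankEq _ hrank
  -- Equal ranks make the quotient finite, and its order kills it.
  refine ⟨Nat.card (M ⧸ (ker A ⊔ range A)), Nat.card_pos.ne', fun x => ?_⟩
  rw [← Submodule.Quotient.mk_eq_zero, Submodule.Quotient.mk_smul]
  exact card_nsmul_eq_zero'

end LinearMap

/-! ### Torsion points, subtori and isogenies -/

namespace ComplexTorus

instance (X : ComplexTorus.{u}) : Module.Finite ℤ X.Λ := ZLattice.module_finite ℝ X.Λ

instance (X : ComplexTorus.{u}) : Module.Free ℤ X.Λ := ZLattice.module_free ℝ X.Λ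

theorem proj_eq_zero_iff (X : ComplexTorus.{u}) {v : X.V} : X.proj v = 0 ↔ v ∈ X.Λ :=
  Submodule.Quotient.mk_eq_zero _

/-- The homomorphism of tori induced by a `ℂ`-linear map which respects the lattices. -/
noncomputable def Hom.ofLinearMap {X Y : ComplexTorus.{u}} (L : X.V →ₗ[ℂ] Y.V)
    (hL : ∀ l ∈ X.Λ, L l ∈ Y.Λ) : Hom X Y where
  toAddMonoidHom := (X.Λ.mapQ Y.Λ (L.restrictScalars ℤ) hL).toAddMonoidHom
  holomorphic _ := ⟨Set.univ, isOpen_univ, trivial, L,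
    (LinearMap.toContinuousLinearMap L).differentiable.differentiableOn, fun _ _ => rfl⟩

theorem Hom.analyticRep_mem {X Y : ComplexTorus.{u}} (f : Hom X Y) {l : X.V} (hl : l ∈ X.Λ) :
    f.analyticRep l ∈ Y.Λ := by
  rw [← proj_eq_zero_iff, ← f.analyticRep_spec, X.proj_eq_zero_iff.2 hl]
  exact map_zero f.toAddMonoidHom

/-- A complex torus has only finitely many points of order dividing `m ≠ 0`. -/
theorem finite_torsion (X : ComplexTorus.{u}) {m : ℕ} (hm : m ≠ 0) :
    {x : X.Pt | m • x = 0}.Finite := by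
  have hm' : (m : ℂ) ≠ 0 := Nat.cast_ne_zero.2 hm
  -- The `m`-torsion lies in the image of `m⁻¹Λ`, a finitely generated torsion group, hence finite.
  let φ : X.Λ →ₗ[ℤ] X.Pt :=
    X.proj ∘ₗ ((LinearMap.lsmul ℂ X.V (m : ℂ)⁻¹).restrictScalars ℤ) ∘ₗ X.Λ.subtype
  have hφ (l : X.Λ) : φ l = X.proj ((m : ℂ)⁻¹ • (l : X.V)) := rfl
  have htors : Module.IsTorsion ℤ (LinearMap.range φ) := by
    rintro ⟨_, l, rfl⟩
    refine ⟨⟨(m : ℤ), mem_nonZeroDivisors_of_ne_zero (by exact_mod_cast hm)⟩, Subtype.ext ?_⟩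
    change (m : ℤ) • φ l = 0
    rw [hφ, natCast_zsmul, ← map_nsmul, proj_eq_zero_iff, ← Nat.cast_smul_eq_nsmul ℂ,
      smul_inv_smul₀ hm']
    exact l.2
  have hfin : Finite (LinearMap.range φ) := Module.finite_of_fg_torsion _ htors
  refine (Set.toFinite (LinearMap.range φ : Set X.Pt)).subset fun x hx => ?_
  obtain ⟨v, rfl⟩ := X.Λ.mkQ_surjective x
  have hv : (m : ℂ) • v ∈ X.Λ := by
    rw [Nat.cast_smul_eq_nsmul ℂ, ← proj_eq_zero_iff, map_nsmul]
    exact hx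
  exact ⟨⟨_, hv⟩, by rw [hφ]; simp only [inv_smul_smul₀ hm']⟩

/-- The lattice `Λ ∩ W` in a complex subspace `W` of the universal cover. -/
abbrev subLattice (X : ComplexTorus.{u}) (W : Submodule ℂ X.V) : Submodule ℤ W :=
  X.Λ.comap (W.subtype.restrictScalars ℤ)

instance (X : ComplexTorus.{u}) (W : Submodule ℂ X.V) : DiscreteTopology (X.subLattice W) :=
  ZLattice.comap_discreteTopology ℝ X.Λ (e := W.subtype.restrictScalars ℝ)
    continuous_subtype_val Subtype.val_injective

/-- The subtorus `W / (Λ ∩ W)` of a complex subspace `W` which is spanned by `Λ ∩ W`. -/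
noncomputable def sub (X : ComplexTorus.{u}) (W : Submodule ℂ X.V)
    (hW : Submodule.span ℝ (X.subLattice W : Set W) = ⊤) : ComplexTorus.{u} :=
  letI : IsZLattice ℝ (X.subLattice W) := ⟨hW⟩
  { V := W, Λ := X.subLattice W }

section sub

variable {X : ComplexTorus.{u}} {W : Submodule ℂ X.V}
  (hW : Submodule.span ℝ (X.subLattice W : Set W) = ⊤)

theorem dim_sub : (X.sub W hW).dim = Module.finrank ℂ W := rfl

/-- Positivity and integrality of `H` both survive restriction to `W`. -/
theorem IsAbelianVariety.sub (hX : X.IsAbelianVariety) : (X.sub W hW).IsAbelianVariety := by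
  obtain ⟨H, hH⟩ := hX
  refine ⟨(H.compl₂ W.subtype).comp W.subtype, ⟨fun v w => hH.hermitian _ _, fun v hv => ?_,
    fun l hl m hm => hH.integral _ hl _ hm⟩⟩
  exact hH.pos (W.subtype v) fun h0 => hv (Subtype.ext h0)

/-- The inclusion of a subtorus. -/
noncomputable def subInclusion : Hom (X.sub W hW) X :=
  Hom.ofLinearMap (X := X.sub W hW) W.subtype fun _ hl => hl

theorem subInclusion_injective : Function.Injective (subInclusion hW) := by
  refine (injective_iff_map_eq_zero (subInclusion hW).toAddMonoidHom).2 fun x hx => ?_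
  obtain ⟨v, rfl⟩ := (X.sub W hW).Λ.mkQ_surjective x
  exact (proj_eq_zero_iff _).2 (X.proj_eq_zero_iff.1 hx)

theorem range_subInclusion : Set.range (subInclusion hW) = X.proj '' W := by
  ext x
  constructor
  · rintro ⟨y, rfl⟩
    obtain ⟨v, rfl⟩ := (X.sub W hW).Λ.mkQ_surjective y
    exact ⟨W.subtype v, v.2, rfl⟩
  · rintro ⟨v, hv, rfl⟩
    exact ⟨(X.sub W hW).proj ⟨v, hv⟩, rfl⟩

end sub

/-- If `W₁` is a complement of `W₂` and `m Λ ⊆ (Λ ∩ W₁) + (Λ ∩ W₂)`, then `Λ ∩ W₁` spans `W₁`. -/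
theorem span_subLattice_eq_top (X : ComplexTorus.{u}) {W₁ W₂ : Submodule ℂ X.V}
    (hW : IsCompl W₁ W₂) {m : ℕ} (hm : m ≠ 0)
    (hΛ : ∀ l ∈ X.Λ, ∃ a ∈ X.Λ, a ∈ W₁ ∧ ∃ b ∈ X.Λ, b ∈ W₂ ∧ m • l = a + b) :
    Submodule.span ℝ (X.subLattice W₁ : Set W₁) = ⊤ := by
  -- Projecting along `W₂` sends `Λ` into `m⁻¹(Λ ∩ W₁)`, and `Λ` spans `V` over `ℝ`.
  let p : X.V →ₗ[ℝ] W₁ := (W₁.projectionOnto W₂ hW).restrictScalars ℝ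
  have hp1 (a : X.V) (ha : a ∈ W₁) : p a = ⟨a, ha⟩ :=
    Submodule.projectionOnto_apply_left hW ⟨a, ha⟩
  have hp2 (b : X.V) (hb : b ∈ W₂) : p b = 0 :=
    (Submodule.projectionOnto_apply_eq_zero_iff hW).2 hb
  have hm' : (m : ℝ) ≠ 0 := Nat.cast_ne_zero.2 hm
  have hle : Submodule.span ℝ (X.Λ : Set X.V) ≤
      (Submodule.span ℝ (X.subLattice W₁ : Set W₁)).comap p := by
    refine Submodule.span_le.2 fun l hl => ?_
    obtain ⟨a, ha, haW, b, -, hbW, hab⟩ := hΛ l hl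
    have h : (m : ℝ) • p l = ⟨a, haW⟩ := by
      rw [Nat.cast_smul_eq_nsmul, ← map_nsmul, hab, map_add, hp1 a haW, hp2 b hbW, add_zero]
    rw [SetLike.mem_coe, Submodule.mem_comap, ← inv_smul_smul₀ hm' (p l), h]
    exact Submodule.smul_mem _ _ (Submodule.subset_span ha)
  rw [IsZLattice.span_top] at hle
  refine eq_top_iff.2 fun w _ => ?_
  have := hle (Submodule.mem_top (x := (w : X.V)))
  rwa [Submodule.mem_comap, hp1 _ w.2] at this

/-- Complementary subspaces `W₁`, `W₂` with `m Λ ⊆ (Λ ∩ W₁) + (Λ ∩ W₂)` give an isogeny onto the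
product of the corresponding subtori. -/
theorem isIsogenous_prod_sub (X : ComplexTorus.{u}) {W₁ W₂ : Submodule ℂ X.V}
    (hW : IsCompl W₁ W₂) {m : ℕ} (hm : m ≠ 0)
    (hΛ : ∀ l ∈ X.Λ, ∃ a ∈ X.Λ, a ∈ W₁ ∧ ∃ b ∈ X.Λ, b ∈ W₂ ∧ m • l = a + b)
    (h₁ : Submodule.span ℝ (X.subLattice W₁ : Set W₁) = ⊤)
    (h₂ : Submodule.span ℝ (X.subLattice W₂ : Set W₂) = ⊤) :
    X.IsIsogenous ((X.sub W₁ h₁).prod (X.sub W₂ h₂)) := by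
  have hm' : (m : ℂ) ≠ 0 := Nat.cast_ne_zero.2 hm
  let e : (W₁ × W₂) ≃ₗ[ℂ] X.V := Submodule.prodEquivOfIsCompl W₁ W₂ hW
  have he (w : W₁ × W₂) : e w = w.1 + w.2 := rfl
  -- The components of a lattice vector lie only in `m⁻¹Λ`; the factor `m` makes `L` respect the
  -- lattices.
  let L : X.V →ₗ[ℂ] W₁ × W₂ := (m : ℂ) • e.symm.toLinearMap
  have hL (v : X.V) : L v = e.symm (m • v) := by
    rw [← Nat.cast_smul_eq_nsmul ℂ, map_smul]
    rfl
  let P := (X.sub W₁ h₁).prod (X.sub W₂ h₂)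
  have hLΛ : ∀ l ∈ X.Λ, L l ∈ P.Λ := by
    intro l hl
    obtain ⟨a, ha, haW, b, hb, hbW, hab⟩ := hΛ l hl
    have : L l = (⟨a, haW⟩, ⟨b, hbW⟩) := by
      rw [hL, LinearEquiv.symm_apply_eq, hab, he]
    rw [this]
    exact ⟨ha, hb⟩
  refine ⟨Hom.ofLinearMap (Y := P) L hLΛ, fun y => ?_, (X.finite_torsion hm).subset fun x hx => ?_⟩
  · obtain ⟨w, rfl⟩ := P.Λ.mkQ_surjective y
    have hLw (w : W₁ × W₂) : L ((m : ℂ)⁻¹ • e w) = w := by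
      rw [hL, ← Nat.cast_smul_eq_nsmul ℂ, smul_inv_smul₀ hm', LinearEquiv.symm_apply_apply]
    exact ⟨X.proj ((m : ℂ)⁻¹ • e w), congrArg P.proj (hLw w)⟩
  · obtain ⟨v, rfl⟩ := X.Λ.mkQ_surjective x
    have hv : L v ∈ P.Λ := P.proj_eq_zero_iff.1 hx
    -- As `e (L v) = m • v`, the kernel consists of `m`-torsion points.
    have hv' : e (L v) ∈ X.Λ := X.Λ.add_mem hv.1 hv.2
    rw [hL, LinearEquiv.apply_symm_apply] at hv'
    rw [Set.mem_ofPred_eq, ← map_nsmul]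
    exact X.proj_eq_zero_iff.2 hv'

/-- An endomorphism of `V` which respects `Λ`, with complementary kernel and range, splits `Λ` up to
finite index. -/
theorem exists_nsmul_eq_add (X : ComplexTorus.{u}) (M : Module.End ℂ X.V)
    (hM : ∀ l ∈ X.Λ, M l ∈ X.Λ) (hd : Disjoint (LinearMap.ker M) (LinearMap.range M)) :
    ∃ m : ℕ, m ≠ 0 ∧ ∀ l ∈ X.Λ, ∃ a ∈ X.Λ, a ∈ LinearMap.ker M ∧
      ∃ b ∈ X.Λ, b ∈ LinearMap.range M ∧ m • l = a + b := by
  let A : X.Λ →ₗ[ℤ] X.Λ := (M.restrictScalars ℤ).restrict hM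
  have hA (l : X.Λ) : (A l : X.V) = M l := rfl
  have hker {l : X.Λ} (hl : l ∈ LinearMap.ker A) : (l : X.V) ∈ LinearMap.ker M := by
    rw [LinearMap.mem_ker, ← hA, LinearMap.mem_ker.1 hl]
    rfl
  have hrange {l : X.Λ} (hl : l ∈ LinearMap.range A) : (l : X.V) ∈ LinearMap.range M := by
    obtain ⟨k, rfl⟩ := hl
    exact ⟨k, rfl⟩
  obtain ⟨m, hm, h⟩ := A.exists_nsmul_mem_ker_sup_range <| Submodule.disjoint_def.2
    fun l h1 h2 => Subtype.ext (Submodule.disjoint_def.1 hd _ (hker h1) (hrange h2))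
  refine ⟨m, hm, fun l hl => ?_⟩
  obtain ⟨a, ha, b, hb, hab⟩ := Submodule.mem_sup.1 (h ⟨l, hl⟩)
  exact ⟨a, a.2, hker ha, b, b.2, hrange hb, by simpa using congrArg Subtype.val hab.symm⟩

end ComplexTorus

/-! ### Generalized eigenspaces -/

namespace Module.End

variable {K V : Type*} [Field K] [AddCommGroup V] [Module K V] [FiniteDimensional K V]

/-- The Fitting decomposition at an eigenvalue. -/
theorem exists_ker_pow_eq_maxGenEigenspace (L : Module.End K V) (μ : K) :
    ∃ n : ℕ, LinearMap.ker ((L - μ • 1) ^ n) = L.maxGenEigenspace μ ∧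
      IsCompl (LinearMap.ker ((L - μ • 1) ^ n)) (LinearMap.range ((L - μ • 1) ^ n)) := by
  -- One exponent must serve both the stabilization of the generalized eigenspaces and the Fitting
  -- splitting.
  obtain ⟨n, hn, hc⟩ := (((Filter.eventually_ge_atTop (L.maxGenEigenspaceIndex μ))).and
    (LinearMap.eventually_isCompl_ker_pow_range_pow (L - μ • 1))).exists
  refine ⟨n, le_antisymm ?_ ?_, hc⟩
  · rw [← genEigenspace_nat]
    exact (L.genEigenspace μ).monotone le_top
  · rw [maxGenEigenspace_eq, ← genEigenspace_nat]
    exact (L.genEigenspace μ).monotone (by exact_mod_cast hn)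

/-- On `ker L` the map `L - μ` is multiplication by `-μ ≠ 0`, so it cannot be nilpotent there. Thus
`L` is injective on the eigenspace, and surjective by finite dimension. -/
theorem image_maxGenEigenspace (L : Module.End K V) {μ : K} (hμ : μ ≠ 0) :
    L '' L.maxGenEigenspace μ = L.maxGenEigenspace μ := by
  have hmaps : ∀ x ∈ L.maxGenEigenspace μ, L x ∈ L.maxGenEigenspace μ :=
    mapsTo_maxGenEigenspace_of_comm (Commute.refl L) μ
  have hinj : Function.Injective (L.restrict hmaps) := by
    rw [← LinearMap.ker_eq_bot, LinearMap.ker_eq_bot']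
    intro x hx
    have hx0 : L x = 0 := congrArg Subtype.val hx
    obtain ⟨k, hk⟩ := (mem_maxGenEigenspace L μ x).1 x.2
    have hpow (k : ℕ) : ((L - μ • 1) ^ k) (x : V) = (-μ) ^ k • (x : V) := by
      induction k with
      | zero => simp
      | succ k ih => rw [pow_succ', mul_apply, ih, map_smul]; simp [hx0, pow_succ, mul_smul]
    rw [hpow, smul_eq_zero] at hk
    exact Subtype.ext (hk.resolve_left (pow_ne_zero _ (neg_ne_zero.2 hμ)))
  refine Set.Subset.antisymm (Set.image_subset_iff.2 hmaps) fun y hy => ?_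
  obtain ⟨x, hx⟩ := (LinearMap.injective_iff_surjective.1 hinj) ⟨y, hy⟩
  exact ⟨x, x.2, congrArg Subtype.val hx⟩

end Module.End

theorem proposition4p5 (X : ComplexTorus.{u}) (hX : X.IsAbelianVariety)
    (g h : ℕ) (hg : X.dim = g)
    (f : ComplexTorus.Hom X X) (hf : f.IsAutomorphism)
    (hmult : f.analyticRep.charpoly.rootMultiplicity 1 = h)
    (h_pos : 1 ≤ h) (h_lt : h < g) :
    ∃ Y₁ Y₂ : ComplexTorus.{u},
      Y₁.IsAbelianVariety ∧ Y₂.IsAbelianVariety ∧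
      Y₁.dim = h ∧
      X.IsIsogenous (Y₁.prod Y₂) ∧
      ∃ ι : ComplexTorus.Hom Y₁ X, Function.Injective ι ∧
        f '' Set.range ι = Set.range ι := by
  obtain ⟨n, hn, hc⟩ := Module.End.exists_ker_pow_eq_maxGenEigenspace f.analyticRep 1
  set N : Module.End ℂ X.V := f.analyticRep - (1 : ℂ) • 1 with hN
  have hNΛ : ∀ k : ℕ, ∀ l ∈ X.Λ, (N ^ k) l ∈ X.Λ := by
    intro k
    induction k with
    | zero => exact fun l hl => hl
    | succ k ih =>
      intro l hl
      rw [pow_succ, Module.End.mul_apply]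
      refine ih _ ?_
      simpa [hN] using X.Λ.sub_mem (f.analyticRep_mem hl) hl
  obtain ⟨m, hm, hΛ⟩ := X.exists_nsmul_eq_add (N ^ n) (hNΛ n) hc.disjoint
  have hΛ' : ∀ l ∈ X.Λ, ∃ a ∈ X.Λ, a ∈ LinearMap.range (N ^ n) ∧
      ∃ b ∈ X.Λ, b ∈ LinearMap.ker (N ^ n) ∧ m • l = a + b := by
    intro l hl
    obtain ⟨a, ha, haW, b, hb, hbW, hab⟩ := hΛ l hl
    exact ⟨b, hb, hbW, a, ha, haW, by rw [hab, add_comm]⟩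
  have h₁ := X.span_subLattice_eq_top hc hm hΛ
  have h₂ := X.span_subLattice_eq_top hc.symm hm hΛ'
  refine ⟨X.sub _ h₁, X.sub _ h₂, hX.sub h₁, hX.sub h₂, ?_,
    X.isIsogenous_prod_sub hc hm hΛ h₁ h₂, ComplexTorus.subInclusion h₁,
    ComplexTorus.subInclusion_injective h₁, ?_⟩
  · rw [ComplexTorus.dim_sub, hn, LinearMap.finrank_maxGenEigenspace_eq, hmult]
  -- The image of `Y₁` is `proj '' W`, so the claim reduces to `ρ_a(f)(W) = W` upstairs.
  · rw [ComplexTorus.range_subInclusion, hn, Set.image_image]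
    simp only [f.analyticRep_spec]
    rw [← Set.image_image X.proj f.analyticRep,
      Module.End.image_maxGenEigenspace _ one_ne_zero]
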